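/- Let $R$ be an associative ring with unit; "module" means left $R$-module. A complex $X$ is a $\mathbb Z$-indexed sequence of modules with differentials $d_n\colon X_n\to X_{n-1}$, $d_nd_{n+1}=0$; $\mathscr C(R)$ is the category of complexes. For a module $M$ and $n\in\mathbb Z$, $\underline{M}[n]$ is the complex with $M$ in degree $n$ and $0$ in all other degrees. A complex is finitely presented if it is bounded and all its components are finitely presented modules. In an abelian category $\mathscr A$ with enough projectives, the subprojectivity domain $\underline{\mathfrak{Pr}}^{-1}_{\mathscr A}(M)$ of an object $M$ consists of the objects $N$ such that for every epimorphism $g\colon B\to N$ and every morphism $f\colon M\to N$ there is a morphism $h\colon M\to B$ with $gh=f$. A complex $F$ is DG-flat if every $F_n$ is flat and, for every exact complex $E$ of right $R$-modules, the complex $E\otimes^\bullet F$, with $(E\otimes^\bullet F)_n=\bigoplus_{i+j=n}E_i\otimes_RF_j$ and $d(x\otimes y)=dx\otimes y+(-1)^i x\otimes dy$ for $x\in E_i$, is exact. The ring $R$ is left semi-hereditary (respectively, left coherent) if every finitely generated left ideal of $R$ is projective (respectively, finitely presented). The following statements are equivalent. 1. $R$ is left semi-hereditary. 2. $R$ is left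 coherent and, for every finitely presented complex $M$ and every exact complex $N$, if $N_n\in\underline{\mathfrak{Pr}}^{-1}_{R\text{-Mod}}(M_n)$ for every $n\in\mathbb Z$, then $N\in\underline{\mathfrak{Pr}}^{-1}_{\mathscr C(R)}(M)$. 3. $R$ is left coherent and, for every finitely presented module $M$, every exact complex $N$ and every $n\in\mathbb Z$, if $N_n\in\underline{\mathfrak{Pr}}^{-1}_{R\text{-Mod}}(M)$, then $N\in\underline{\mathfrak{Pr}}^{-1}_{\mathscr C(R)}(\underline{M}[n])$. 4. $R$ is left coherent and every subcomplex of a DG-flat complex is DG-flat. -/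

import Mathlib

open CategoryTheory
open scoped TensorProduct

universe u

/-! ### Rings and modules -/

/-- `R` is left semi-hereditary: every finitely generated left ideal is projective
(`Ideal R` is the type of left ideals of `R`). -/
def IsLeftSemihereditary (R : Type u) [Ring R] : Prop :=
  ∀ I : Ideal R, I.FG → Module.Projective R I

/-- `R` is left coherent: every finitely generated left ideal is finitely presented. -/
def IsLeftCoherent (R : Type u) [Ring R] : Prop :=
  ∀ I : Ideal R, I.FG → Module.FinitePresentation R I

/-! ### The tensor product over a not necessarily commutative ring

Right `R`-modules are modules over `Rᵐᵒᵖ`, with `a * r = MulOpposite.op r • a`. -/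

section BalancedTensor

variable (R : Type u) [Ring R]

/-- The subgroup of `A ⊗[ℤ] B` generated by the elements `(a * r) ⊗ b - a ⊗ (r * b)`. -/
def balancingSubgroup (A B : Type u) [AddCommGroup A] [Module Rᵐᵒᵖ A]
    [AddCommGroup B] [Module R B] : AddSubgroup (A ⊗[ℤ] B) :=
  AddSubgroup.closure {x | ∃ (a : A) (r : R) (b : B),
    x = (MulOpposite.op r • a) ⊗ₜ[ℤ] b - a ⊗ₜ[ℤ] (r • b)}

/-- The abelian group `A ⊗_R B`, for a right `R`-module `A` and a left `R`-module `B`. -/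
abbrev BalancedTensor (A B : Type u) [AddCommGroup A] [Module Rᵐᵒᵖ A]
    [AddCommGroup B] [Module R B] : Type u :=
  (A ⊗[ℤ] B) ⧸ balancingSubgroup R A B

variable {A A' A'' B B' B'' : Type u}
  [AddCommGroup A] [Module Rᵐᵒᵖ A] [AddCommGroup A'] [Module Rᵐᵒᵖ A']
  [AddCommGroup A''] [Module Rᵐᵒᵖ A'']
  [AddCommGroup B] [Module R B] [AddCommGroup B'] [Module R B']
  [AddCommGroup B''] [Module R B'']

/-- The element `a ⊗ b` of `A ⊗_R B`. -/
def BalancedTensor.tmul (a : A) (b : B) : BalancedTensor R A B :=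
  QuotientAddGroup.mk (a ⊗ₜ[ℤ] b)

variable {R}

theorem balancingSubgroup_le_comap (f : A →ₗ[Rᵐᵒᵖ] A') (g : B →ₗ[R] B') :
    balancingSubgroup R A B ≤ (balancingSubgroup R A' B').comap
      (TensorProduct.map f.toAddMonoidHom.toIntLinearMap
        g.toAddMonoidHom.toIntLinearMap).toAddMonoidHom := by
  refine (AddSubgroup.closure_le _).2 ?_
  rintro x ⟨a, r, b, rfl⟩
  exact AddSubgroup.subset_closure ⟨f a, r, g b, by simp⟩

/-- The homomorphism `f ⊗ g : A ⊗_R B → A' ⊗_R B'`, sending `a ⊗ b` to `f a ⊗ g b`. -/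
def BalancedTensor.map (f : A →ₗ[Rᵐᵒᵖ] A') (g : B →ₗ[R] B') :
    BalancedTensor R A B →+ BalancedTensor R A' B' :=
  QuotientAddGroup.map _ _
    (TensorProduct.map f.toAddMonoidHom.toIntLinearMap
      g.toAddMonoidHom.toIntLinearMap).toAddMonoidHom
    (balancingSubgroup_le_comap f g)

theorem BalancedTensor.hom_ext {C : Type u} [AddCommGroup C] {φ ψ : BalancedTensor R A B →+ C}
    (h : ∀ (a : A) (b : B), φ (BalancedTensor.tmul R a b) = ψ (BalancedTensor.tmul R a b)) :
    φ = ψ := by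
  refine QuotientAddGroup.addMonoidHom_ext _ (AddMonoidHom.ext fun x => ?_)
  induction x using TensorProduct.induction_on with
  | zero => rw [map_zero, map_zero]
  | tmul a b => exact h a b
  | add x y hx hy => rw [map_add, map_add, hx, hy]

theorem BalancedTensor.map_tmul (f : A →ₗ[Rᵐᵒᵖ] A') (g : B →ₗ[R] B') (a : A) (b : B) :
    BalancedTensor.map f g (BalancedTensor.tmul R a b) = BalancedTensor.tmul R (f a) (g b) := rfl

theorem BalancedTensor.map_map (f : A →ₗ[Rᵐᵒᵖ] A') (f' : A' →ₗ[Rᵐᵒᵖ] A'')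
    (g : B →ₗ[R] B') (g' : B' →ₗ[R] B'') (x : BalancedTensor R A B) :
    BalancedTensor.map f' g' (BalancedTensor.map f g x) =
      BalancedTensor.map (f' ∘ₗ f) (g' ∘ₗ g) x := by
  have h : (BalancedTensor.map f' g').comp (BalancedTensor.map f g) =
      BalancedTensor.map (f' ∘ₗ f) (g' ∘ₗ g) :=
    BalancedTensor.hom_ext fun a b => rfl
  exact DFunLike.congr_fun h x

theorem BalancedTensor.map_zero_left (g : B →ₗ[R] B') :
    BalancedTensor.map (0 : A →ₗ[Rᵐᵒᵖ] A') g = 0 :=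
  BalancedTensor.hom_ext fun a b => by
    rw [BalancedTensor.map_tmul, BalancedTensor.tmul, LinearMap.zero_apply,
      TensorProduct.zero_tmul]; rfl

theorem BalancedTensor.map_zero_right (f : A →ₗ[Rᵐᵒᵖ] A') :
    BalancedTensor.map f (0 : B →ₗ[R] B') = 0 :=
  BalancedTensor.hom_ext fun a b => by
    rw [BalancedTensor.map_tmul, BalancedTensor.tmul, LinearMap.zero_apply,
      TensorProduct.tmul_zero]; rfl

variable (R) in
/-- A left `R`-module `B` is flat: `- ⊗_R B` preserves injectivity of homomorphisms of
right `R`-modules. -/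
def IsFlatLeftModule (B : Type u) [AddCommGroup B] [Module R B] : Prop :=
  ∀ (A A' : Type u) [AddCommGroup A] [AddCommGroup A'] [Module Rᵐᵒᵖ A] [Module Rᵐᵒᵖ A']
    (f : A →ₗ[Rᵐᵒᵖ] A'), Function.Injective f →
      Function.Injective (BalancedTensor.map f (LinearMap.id : B →ₗ[R] B))

end BalancedTensor

/-! ### Complexes

A complex of left `R`-modules is an object of `ChainComplex (ModuleCat.{u} R) ℤ`: modules `X n`,
`n : ℤ`, with differentials `X n → X (n - 1)`. It is exact iff it is `HomologicalComplex.Acyclic`. -/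

section TensorComplex

variable {R : Type u} [Ring R]
variable (E : ChainComplex (ModuleCat.{u} Rᵐᵒᵖ) ℤ) (F : ChainComplex (ModuleCat.{u} R) ℤ)

/-- The degree `n` part `⨁_{i + j = n} E_i ⊗_R F_j` of the tensor product of complexes. -/
abbrev TensorDeg (n : ℤ) : Type u :=
  DirectSum {p : ℤ × ℤ // p.1 + p.2 = n} fun p => BalancedTensor R (E.X p.1.1) (F.X p.1.2)

/-- The differential of the tensor product of complexes from degree `n` to degree `m = n - 1`:
`d (x ⊗ y) = d x ⊗ y + (-1) ^ i • (x ⊗ d y)` for `x` in `E_i` and `y` in `F_j`. -/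
noncomputable def tensorDiff (n m : ℤ) (h : m + 1 = n) : TensorDeg E F n →+ TensorDeg E F m :=
  DirectSum.toAddMonoid fun p =>
    (DirectSum.of (fun q : {q : ℤ × ℤ // q.1 + q.2 = m} =>
          BalancedTensor R (E.X q.1.1) (F.X q.1.2))
        ⟨(p.1.1 - 1, p.1.2), by have := p.2; simp only; omega⟩).comp
      (BalancedTensor.map (E.d p.1.1 (p.1.1 - 1)).hom LinearMap.id) +
    ((p.1.1.negOnePow : ℤˣ) : ℤ) •
      (DirectSum.of (fun q : {q : ℤ × ℤ // q.1 + q.2 = m} =>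
          BalancedTensor R (E.X q.1.1) (F.X q.1.2))
        ⟨(p.1.1, p.1.2 - 1), by have := p.2; simp only; omega⟩).comp
      (BalancedTensor.map LinearMap.id (F.d p.1.2 (p.1.2 - 1)).hom)

theorem tensorDiff_comp_tensorDiff (n m l : ℤ) (h : m + 1 = n) (h' : l + 1 = m) :
    (tensorDiff E F m l h').comp (tensorDiff E F n m h) = 0 := by
  refine DirectSum.addHom_ext fun p x => ?_
  obtain ⟨⟨i, j⟩, hp⟩ := p
  have hE : (E.d (i - 1) (i - 1 - 1)).hom ∘ₗ (E.d i (i - 1)).hom = 0 := by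
    rw [← ModuleCat.hom_comp, E.d_comp_d, ModuleCat.hom_zero]
  have hF : (F.d (j - 1) (j - 1 - 1)).hom ∘ₗ (F.d j (j - 1)).hom = 0 := by
    rw [← ModuleCat.hom_comp, F.d_comp_d, ModuleCat.hom_zero]
  simp only [tensorDiff, AddMonoidHom.comp_apply, DirectSum.toAddMonoid_of,
    AddMonoidHom.add_apply, AddMonoidHom.smul_apply, map_add, map_zsmul,
    BalancedTensor.map_map, hE, hF,
    LinearMap.comp_id, LinearMap.id_comp, BalancedTensor.map_zero_left,
    BalancedTensor.map_zero_right, AddMonoidHom.zero_apply, map_zero, Int.negOnePow_sub,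
    Int.negOnePow_one, mul_neg, mul_one, Units.val_neg, smul_zero, zero_add, add_zero]
  rw [← add_zsmul, neg_add_cancel, zero_zsmul]

/-- The tensor product `E ⊗ F` of a complex of right `R`-modules and a complex of left
`R`-modules, a complex of abelian groups. -/
noncomputable def tensorComplex : ChainComplex AddCommGrpCat.{u} ℤ where
  X n := AddCommGrpCat.of (TensorDeg E F n)
  d n m := if h : m + 1 = n then AddCommGrpCat.ofHom (tensorDiff E F n m h) else 0
  shape n m h := dif_neg h
  d_comp_d' n m l h h' := by
    have h1 : m + 1 = n := h
    have h2 : l + 1 = m := h'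
    rw [dif_pos h1, dif_pos h2, ← AddCommGrpCat.ofHom_comp, tensorDiff_comp_tensorDiff]
    rfl

/-- A complex `F` of left `R`-modules is DG-flat: each `F_n` is flat, and `E ⊗ F` is exact for
every exact complex `E` of right `R`-modules. -/
def IsDGFlat : Prop :=
  (∀ n : ℤ, IsFlatLeftModule R (F.X n)) ∧
    ∀ E : ChainComplex (ModuleCat.{u} Rᵐᵒᵖ) ℤ, E.Acyclic → (tensorComplex E F).Acyclic

/-- A complex is finitely presented: it is bounded and has finitely presented components. -/
def IsFinitelyPresentedComplex : Prop :=
  (∃ a b : ℤ, ∀ n : ℤ, n < a ∨ b < n → Limits.IsZero (F.X n)) ∧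
    ∀ n : ℤ, Module.FinitePresentation R (F.X n)

end TensorComplex

/-- The subprojectivity domain of `M`: the objects `N` such that every morphism `f : M ⟶ N` lifts
through every epimorphism `g : B ⟶ N`. -/
def subprojectivityDomain {C : Type*} [Category C] (M : C) : Set C :=
  {N | ∀ ⦃B : C⦄ (g : B ⟶ N) [Epi g] (f : M ⟶ N), ∃ h : M ⟶ B, h ≫ g = f}

/-- The sphere complex of `M` shifted by `n`: `M` in degree `n`, and zero in all other degrees. -/
noncomputable abbrev shiftedSphere {R : Type u} [Ring R] (M : ModuleCat.{u} R) (n : ℤ) :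
    ChainComplex (ModuleCat.{u} R) ℤ :=
  (HomologicalComplex.single (ModuleCat.{u} R) (ComplexShape.down ℤ) n).obj M

/-! Over a left semi-hereditary ring, finitely generated submodules of projective modules are
projective and submodules of flat modules are flat. Both implications starting from 1 rest on this.

For 1 → 2, the hypothesis on components makes each `f_n : M_n → N_n` factor through a projective
`Q_n`. Dividing each `M_n` by the kernel of `M_n → Q_n × Q_(n-1)` factors `f` through a bounded
complex of projectives (`IsLeftSemihereditary.exists_projective_factorization`). A morphism from
such a complex to an exact one is null homotopic (`exists_nullHomotopy`), and it lifts through any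
epimorphism because its homotopy lifts degree by degree. Spheres give 2 → 3. For 3 → 1, take the
exact complex `0 → I → R → R/I → 0` with `R` in degree 0: lifting the inclusion of the sphere on `I`
through a contractible complex of projectives exhibits `I` as a retract of a projective
(`Ideal.projective_of_mem_subprojectivityDomain`).

For 1 → 4, a complex `F` of flat modules has flat cycles `Z` and boundaries `B`, so `0 → Z → F → B →
0` remains exact under tensoring. Since `E ⊗ Z` and `E ⊗ B` are exact, so is `E ⊗ F`; thus
DG-flatness is just flatness of components, which passes to subcomplexes. For 4 → 1, the inclusion
`I ⊆ R` of complexes with zero differentials shows that `I` is flat; coherence makes it finitely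
presented, hence projective.

Flatness of `B` is handled through injectivity of its character module `B⁺`, and through the
equational criterion. -/

/-! ### Characters of a left module and of a balanced tensor product -/

section Characters

variable {R : Type u} [Ring R]

/-- The character module of a left `R`-module is a right `R`-module, with `(c * r) b = c (r * b)`. -/
instance CharacterModule.rightModule (B : Type u) [AddCommGroup B] [Module R B] :
    Module Rᵐᵒᵖ (CharacterModule B) where
  smul r c := AddMonoidHom.comp c (DistribSMul.toAddMonoidHom B r.unop)
  one_smul c := CharacterModule.ext _ fun x => congrArg c (one_smul R x)
  mul_smul r s c := CharacterModule.ext _ fun x => congrArg c (mul_smul s.unop r.unop x)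
  smul_zero _ := rfl
  smul_add _ _ _ := rfl
  add_smul r s c := CharacterModule.ext _ fun x =>
    (congrArg c (add_smul r.unop s.unop x)).trans (map_add c _ _)
  zero_smul c := CharacterModule.ext _ fun x => (congrArg c (zero_smul R x)).trans (map_zero c)

variable {A A' A'' B B' B'' : Type u}
  [AddCommGroup A] [Module Rᵐᵒᵖ A] [AddCommGroup A'] [Module Rᵐᵒᵖ A']
  [AddCommGroup A''] [Module Rᵐᵒᵖ A'']
  [AddCommGroup B] [Module R B] [AddCommGroup B'] [Module R B']
  [AddCommGroup B''] [Module R B'']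

/-- Precomposition with a homomorphism of left modules, as a homomorphism of right modules. -/
def CharacterModule.rightDual (f : B →ₗ[R] B') :
    CharacterModule B' →ₗ[Rᵐᵒᵖ] CharacterModule B where
  toFun c := AddMonoidHom.comp c f.toAddMonoidHom
  map_add' _ _ := rfl
  map_smul' r c := CharacterModule.ext _ fun x => (congrArg c (f.map_smul r.unop x)).symm

/-- `ℚ/ℤ` is an injective abelian group. -/
theorem CharacterModule.exists_extension {X Y : Type*} [AddCommGroup X] [AddCommGroup Y]
    (f : X →+ Y) (hf : Function.Injective f) (c : CharacterModule X) :
    ∃ c' : CharacterModule Y, ∀ x, c' (f x) = c x := by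
  obtain ⟨c', h⟩ := CharacterModule.dual_surjective_of_injective f.toIntLinearMap hf c
  exact ⟨c', fun x => congrArg (fun c : CharacterModule X => c x) h⟩

/-- A character vanishing on the kernel of `f` factors through `f`. -/
theorem CharacterModule.exists_factorization {X Y : Type*} [AddCommGroup X] [AddCommGroup Y]
    (f : X →+ Y) (c : CharacterModule X) (hc : ∀ x, f x = 0 → c x = 0) :
    ∃ c' : CharacterModule Y, ∀ x, c' (f x) = c x := by
  obtain ⟨c', h⟩ := CharacterModule.exists_extension (QuotientAddGroup.kerLift f)
    (QuotientAddGroup.kerLift_injective f)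
    (QuotientAddGroup.lift f.ker (c : X →+ AddCircle (1 : ℚ)) hc)
  exact ⟨c', fun x => h (QuotientAddGroup.mk x)⟩

/-- Characters separate the points of the cokernel of `f`. This reduces exactness of tensored
sequences to constructing characters. -/
theorem AddMonoidHom.mem_range_of_characters {X Y : Type*} [AddCommGroup X] [AddCommGroup Y]
    (f : X →+ Y) (y : Y)
    (h : ∀ c : CharacterModule Y, (∀ x, c (f x) = 0) → c y = 0) : y ∈ f.range := by
  rw [← QuotientAddGroup.eq_zero_iff]
  refine CharacterModule.eq_zero_of_character_apply fun c => ?_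
  refine h (AddMonoidHom.comp c (QuotientAddGroup.mk' f.range)) fun x => ?_
  have : (QuotientAddGroup.mk (f x) : Y ⧸ f.range) = 0 :=
    (QuotientAddGroup.eq_zero_iff _).2 ⟨x, rfl⟩
  exact (congrArg c this).trans (map_zero c)

/-- The homomorphism on `A ⊗_R B` given by a balanced biadditive map. -/
def BalancedTensor.lift {C : Type*} [AddCommGroup C] (φ : A →+ B →+ C)
    (h : ∀ (a : A) (r : R) (b : B), φ (MulOpposite.op r • a) b = φ a (r • b)) :
    BalancedTensor R A B →+ C :=
  QuotientAddGroup.lift _ (TensorProduct.liftAddHom (R := ℤ) φ fun n a b => by simp) <| by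
    refine (AddSubgroup.closure_le _).2 ?_
    rintro x ⟨a, r, b, rfl⟩
    simp [h]

theorem BalancedTensor.smul_tmul (a : A) (r : R) (b : B) :
    BalancedTensor.tmul R (MulOpposite.op r • a) b = BalancedTensor.tmul R a (r • b) := by
  refine sub_eq_zero.1 ((QuotientAddGroup.eq_zero_iff _).2 ?_)
  exact AddSubgroup.subset_closure ⟨a, r, b, rfl⟩

variable (R) in
/-- The biadditive map `a, b ↦ a ⊗ b`. -/
def BalancedTensor.mk (A B : Type u) [AddCommGroup A] [Module Rᵐᵒᵖ A]
    [AddCommGroup B] [Module R B] : A →+ B →+ BalancedTensor R A B :=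
  AddMonoidHom.mk' (fun a => AddMonoidHom.mk' (BalancedTensor.tmul R a) fun b b' =>
      congrArg QuotientAddGroup.mk (TensorProduct.tmul_add a b b'))
    fun a a' => AddMonoidHom.ext fun b =>
      congrArg QuotientAddGroup.mk (TensorProduct.add_tmul a a' b)

theorem BalancedTensor.mk_apply (a : A) (b : B) :
    BalancedTensor.mk R A B a b = BalancedTensor.tmul R a b := rfl

theorem BalancedTensor.exists_sum (t : BalancedTensor R A B) :
    ∃ (n : ℕ) (a : Fin n → A) (b : Fin n → B), t = ∑ i, BalancedTensor.tmul R (a i) (b i) := by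
  obtain ⟨t, rfl⟩ := QuotientAddGroup.mk_surjective t
  obtain ⟨S, rfl⟩ := TensorProduct.exists_finset t
  refine ⟨S.card, fun i => (S.equivFin.symm i).1.1, fun i => (S.equivFin.symm i).1.2, ?_⟩
  rw [← QuotientAddGroup.mk'_apply, map_sum, ← Finset.sum_coe_sort,
    ← S.equivFin.symm.sum_comp]
  rfl

/-- The character of `A ⊗_R B` given by a homomorphism from `A` to the characters of `B`. -/
def BalancedTensor.uncurry (φ : A →ₗ[Rᵐᵒᵖ] CharacterModule B) :
    CharacterModule (BalancedTensor R A B) :=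
  BalancedTensor.lift (C := AddCircle (1 : ℚ)) φ.toAddMonoidHom fun a r b =>
    congrArg (fun c : CharacterModule B => c b) (φ.map_smul (MulOpposite.op r) a)

/-- The homomorphism from `A` to the characters of `B` given by a character of `A ⊗_R B`. -/
def BalancedTensor.curry (c : CharacterModule (BalancedTensor R A B)) :
    A →ₗ[Rᵐᵒᵖ] CharacterModule B where
  toFun a := AddMonoidHom.comp c (BalancedTensor.mk R A B a)
  map_add' a a' := CharacterModule.ext _ fun b => by
    change c (BalancedTensor.mk R A B (a + a') b) = c _ + c _
    rw [map_add, AddMonoidHom.add_apply, map_add]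
  map_smul' r a := CharacterModule.ext _ fun b =>
    congrArg c (BalancedTensor.smul_tmul a r.unop b)

theorem BalancedTensor.character_ext {c c' : CharacterModule (BalancedTensor R A B)}
    (h : ∀ a b, c (BalancedTensor.tmul R a b) = c' (BalancedTensor.tmul R a b)) (t) :
    c t = c' t := by
  obtain ⟨n, a, b, rfl⟩ := BalancedTensor.exists_sum t
  simp only [map_sum, h]

theorem BalancedTensor.map_surjective (f : A →ₗ[Rᵐᵒᵖ] A') (g : B →ₗ[R] B')
    (hf : Function.Surjective f) (hg : Function.Surjective g) :
    Function.Surjective (BalancedTensor.map f g) := by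
  intro t
  obtain ⟨n, a, b, rfl⟩ := BalancedTensor.exists_sum t
  choose a' ha using fun i => hf (a i)
  choose b' hb using fun i => hg (b i)
  exact ⟨∑ i, BalancedTensor.tmul R (a' i) (b' i), by
    simp only [map_sum, BalancedTensor.map_tmul, ha, hb]⟩

/-- The character module of a flat left module is an injective right module. -/
theorem IsFlatLeftModule.baer (hB : IsFlatLeftModule R B) :
    Module.Baer Rᵐᵒᵖ (CharacterModule B) := by
  intro J φ
  -- Homomorphisms `J → B⁺` are characters of `J ⊗ B`, so extending `φ` means extending a character
  -- along `J ⊗ B → R ⊗ B`.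
  obtain ⟨c, hc⟩ := CharacterModule.exists_extension _
    (hB J Rᵐᵒᵖ J.subtype J.subtype_injective) (BalancedTensor.uncurry φ)
  refine ⟨BalancedTensor.curry c, fun x hx => CharacterModule.ext _ fun b => ?_⟩
  exact hc (BalancedTensor.tmul R (⟨x, hx⟩ : J) b)

theorem IsFlatLeftModule.of_baer (hB : Module.Baer Rᵐᵒᵖ (CharacterModule B)) :
    IsFlatLeftModule R B := by
  intro A A' _ _ _ _ f hf
  refine (injective_iff_map_eq_zero _).2 fun t ht =>
    CharacterModule.eq_zero_of_character_apply fun c => ?_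
  obtain ⟨φ, hφ⟩ := hB.extension_property f hf (BalancedTensor.curry c)
  have key : c t = BalancedTensor.uncurry φ (BalancedTensor.map f LinearMap.id t) :=
    BalancedTensor.character_ext
      (c' := AddMonoidHom.comp (BalancedTensor.uncurry φ) (BalancedTensor.map f LinearMap.id))
      (fun a b => (congrArg (fun ψ : A →ₗ[Rᵐᵒᵖ] CharacterModule B => ψ a b) hφ).symm) t
  rw [key, ht, map_zero]

/-- Tensoring with a flat left module is exact. -/
theorem IsFlatLeftModule.exact_map (hB : IsFlatLeftModule R B) (f : A →ₗ[Rᵐᵒᵖ] A')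
    (g : A' →ₗ[Rᵐᵒᵖ] A'') (hfg : Function.Exact f g) :
    Function.Exact (BalancedTensor.map f (LinearMap.id : B →ₗ[R] B))
      (BalancedTensor.map g (LinearMap.id : B →ₗ[R] B)) := by
  intro t
  constructor
  · intro ht
    refine AddMonoidHom.mem_range_of_characters _ t fun c hc => ?_
    have hker : LinearMap.ker g ≤ LinearMap.ker (BalancedTensor.curry c) := by
      intro x hx
      obtain ⟨y, rfl⟩ := (hfg x).1 hx
      exact CharacterModule.ext _ fun b => hc (BalancedTensor.tmul R y b)
    -- The curried character descends to `A' / ker g`, which embeds in `A''`, and extends there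
    -- because `B⁺` is injective. Hence `c` factors through `g ⊗ B`.
    obtain ⟨φ, hφ⟩ := hB.baer.extension_property
      ((LinearMap.ker g).liftQ g le_rfl)
      (LinearMap.ker_eq_bot.1 (Submodule.ker_liftQ_eq_bot' _ g rfl))
      ((LinearMap.ker g).liftQ (BalancedTensor.curry c) hker)
    have key : c t = BalancedTensor.uncurry φ (BalancedTensor.map g LinearMap.id t) :=
      BalancedTensor.character_ext
        (c' := AddMonoidHom.comp (BalancedTensor.uncurry φ) (BalancedTensor.map g LinearMap.id))
        (fun a b => (congrArg (fun ψ : _ →ₗ[Rᵐᵒᵖ] CharacterModule B =>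
          ψ (Submodule.Quotient.mk a) b) hφ).symm) t
    rw [key, ht, map_zero]
  · rintro ⟨s, rfl⟩
    rw [BalancedTensor.map_map, hfg.linearMap_comp_eq_zero, BalancedTensor.map_zero_left]
    rfl

/-- Right exactness of the tensor product in the second variable. -/
theorem BalancedTensor.exact_map_right (f : B →ₗ[R] B') (g : B' →ₗ[R] B'')
    (hfg : Function.Exact f g) (hg : Function.Surjective g) :
    Function.Exact (BalancedTensor.map (LinearMap.id : A →ₗ[Rᵐᵒᵖ] A) f)
      (BalancedTensor.map (LinearMap.id : A →ₗ[Rᵐᵒᵖ] A) g) := by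
  intro t
  constructor
  · intro ht
    refine AddMonoidHom.mem_range_of_characters _ t fun c hc => ?_
    have h (a : A) : ∃ c' : CharacterModule B'', ∀ b, c' (g b) = c (BalancedTensor.tmul R a b) :=
      CharacterModule.exists_factorization g.toAddMonoidHom (BalancedTensor.curry c a)
        fun x hx => by
          obtain ⟨y, rfl⟩ := (hfg x).1 hx
          exact hc (BalancedTensor.tmul R a y)
    choose φ hφ using h
    -- Surjectivity of `g` makes the chosen factorizations unique, hence linear in `a`.
    let Φ : A →ₗ[Rᵐᵒᵖ] CharacterModule B'' :=
      { toFun := φ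
        map_add' := fun a a' => CharacterModule.ext _ fun b => by
          obtain ⟨b, rfl⟩ := hg b
          change _ = φ a (g b) + φ a' (g b)
          rw [hφ, hφ, hφ, ← BalancedTensor.mk_apply, map_add, AddMonoidHom.add_apply, map_add]
          rfl
        map_smul' := fun r a => CharacterModule.ext _ fun b => by
          obtain ⟨b, rfl⟩ := hg b
          change _ = φ a (r.unop • g b)
          rw [← map_smul, hφ, hφ, ← BalancedTensor.smul_tmul]
          rfl }
    have key : c t = BalancedTensor.uncurry Φ (BalancedTensor.map LinearMap.id g t) :=
      BalancedTensor.character_ext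
        (c' := AddMonoidHom.comp (BalancedTensor.uncurry Φ) (BalancedTensor.map LinearMap.id g))
        (fun a b => (hφ a b).symm) t
    rw [key, ht, map_zero]
  · rintro ⟨s, rfl⟩
    rw [BalancedTensor.map_map, hfg.linearMap_comp_eq_zero, BalancedTensor.map_zero_right]
    rfl

/-- A short exact sequence of left modules whose last term is flat is pure. -/
theorem IsFlatLeftModule.map_injective (hB : IsFlatLeftModule R B'') (f : B →ₗ[R] B')
    (g : B' →ₗ[R] B'') (hf : Function.Injective f) (hfg : Function.Exact f g)
    (hg : Function.Surjective g) :
    Function.Injective (BalancedTensor.map (LinearMap.id : A →ₗ[Rᵐᵒᵖ] A) f) := by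
  have hg' : Function.Injective (CharacterModule.rightDual g) := fun c c' h =>
    CharacterModule.ext _ fun b => by
      obtain ⟨b, rfl⟩ := hg b
      exact congrArg (fun c : CharacterModule B' => c b) h
  have hf' : Function.Surjective (CharacterModule.rightDual f) := fun c => by
    obtain ⟨c', h⟩ := CharacterModule.exists_extension f.toAddMonoidHom hf c
    exact ⟨c', CharacterModule.ext _ h⟩
  have hgf : Function.Exact (CharacterModule.rightDual g) (CharacterModule.rightDual f) := by
    intro c
    constructor
    · intro hc
      obtain ⟨c', h⟩ := CharacterModule.exists_factorization g.toAddMonoidHom c fun x hx => by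
        obtain ⟨y, rfl⟩ := (hfg x).1 hx
        exact congrArg (fun c : CharacterModule B => c y) hc
      exact ⟨c', CharacterModule.ext _ h⟩
    · rintro ⟨c, rfl⟩
      exact CharacterModule.ext _ fun b =>
        (congrArg c (hfg.apply_apply_eq_zero b)).trans (map_zero c)
  -- Injectivity of the characters of `B''` splits the dual sequence. Composing with the section `σ`
  -- extends every character of `A ⊗ B` along `A ⊗ f`.
  obtain ⟨σ, hσ⟩ := ((hgf.split_tfae hg' hf').out 1 0).1
    (hB.baer.extension_property _ hg' LinearMap.id)
  refine (injective_iff_map_eq_zero _).2 fun t ht =>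
    CharacterModule.eq_zero_of_character_apply fun c => ?_
  have key : c t = BalancedTensor.uncurry (σ ∘ₗ BalancedTensor.curry c)
      (BalancedTensor.map LinearMap.id f t) :=
    BalancedTensor.character_ext
      (c' := AddMonoidHom.comp (BalancedTensor.uncurry (σ ∘ₗ BalancedTensor.curry c))
        (BalancedTensor.map LinearMap.id f))
      (fun a b => (congrArg (fun ψ : CharacterModule B →ₗ[Rᵐᵒᵖ] CharacterModule B =>
        ψ (BalancedTensor.curry c a) b) hσ).symm) t
  rw [key, ht, map_zero]

end Characters

/-! ### The equational criterion of flatness -/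

section Equational

variable {R : Type u} [Ring R] {B : Type u} [AddCommGroup B] [Module R B]

variable (R B) in
/-- Every homomorphism from a finite free module to `B` that kills an element `r` factors through a
homomorphism between finite free modules that kills `r`. -/
def HasFreeFactorizations : Prop :=
  ∀ (n : ℕ) (x : (Fin n → R) →ₗ[R] B) (r : Fin n → R), x r = 0 →
    ∃ (m : ℕ) (p : (Fin n → R) →ₗ[R] (Fin m → R)) (y : (Fin m → R) →ₗ[R] B),
      x = y ∘ₗ p ∧ p r = 0

theorem LinearMap.apply_eq_sum_single {n : ℕ} (x : (Fin n → R) →ₗ[R] B) (r : Fin n → R) :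
    x r = ∑ i, r i • x (Pi.single i 1) := by
  conv_lhs => rw [pi_eq_sum_univ' r, map_sum]
  exact Finset.sum_congr rfl fun i _ => by rw [map_smul]

/-- The tensor `∑ e_i ⊗ x(e_i)` maps to `1 ⊗ x(r) = 0` under `s ↦ ∑ r_i s_i`, so flatness brings it
from the kernel. The kernel elements so obtained are the columns of `p`, and their partners in `B`
define `y`. -/
theorem IsFlatLeftModule.hasFreeFactorizations (hB : IsFlatLeftModule R B) :
    HasFreeFactorizations R B := by
  intro n x r hr
  let φ : (Fin n → R) →ₗ[Rᵐᵒᵖ] R :=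
    { toFun := fun s => ∑ i, r i * s i
      map_add' := fun s t => by simp [mul_add, Finset.sum_add_distrib]
      map_smul' := fun a s => by simp [Finset.sum_mul, mul_assoc] }
  let t : BalancedTensor R (Fin n → R) B :=
    ∑ i, BalancedTensor.tmul R (Pi.single i (1 : R)) (x (Pi.single i 1))
  have ht : BalancedTensor.map φ LinearMap.id t = 0 := by
    have h (i : Fin n) : BalancedTensor.map φ LinearMap.id
        (BalancedTensor.tmul R (Pi.single i (1 : R)) (x (Pi.single i 1))) =
          BalancedTensor.mk R R B 1 (r i • x (Pi.single i 1)) := by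
      rw [BalancedTensor.map_tmul, BalancedTensor.mk_apply, ← BalancedTensor.smul_tmul]
      congr 1
      simp [φ, Pi.single_apply]
    rw [map_sum, Finset.sum_congr rfl fun i _ => h i, ← map_sum, ← x.apply_eq_sum_single, hr,
      map_zero]
  obtain ⟨z, hz⟩ := (hB.exact_map (LinearMap.ker φ).subtype φ φ.exact_subtype_ker_map t).1 ht
  obtain ⟨m, k, y, rfl⟩ := BalancedTensor.exists_sum z
  -- Coordinates `R^n ⊗ B → B^n`, to read off each `x(e_i)`.
  let ev : BalancedTensor R (Fin n → R) B →+ (Fin n → B) :=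
    BalancedTensor.lift
      (AddMonoidHom.mk' (fun s => AddMonoidHom.mk' (fun b i => s i • b)
        fun b b' => funext fun i => smul_add _ _ _)
        fun s s' => AddMonoidHom.ext fun b => funext fun i => add_smul _ _ _)
      fun s a b => funext fun i => mul_smul _ _ _
  have hev (s : Fin n → R) (b : B) :
    ev (BalancedTensor.tmul R s b) = fun i => s i • b := rfl
  have hx (i : Fin n) : x (Pi.single i 1) = ∑ j, (k j : Fin n → R) i • y j := by
    have h := congrFun (congrArg ev hz) i
    simp only [t, map_sum, BalancedTensor.map_tmul, hev, Finset.sum_apply, LinearMap.id_apply,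
      Submodule.subtype_apply, Pi.single_apply, ite_smul, one_smul, zero_smul,
      Finset.sum_ite_eq, Finset.mem_univ, if_true] at h
    exact h.symm
  refine ⟨m, LinearMap.pi fun j => Fintype.linearCombination R (k j : Fin n → R),
    Fintype.linearCombination R y, (Pi.basisFun R (Fin n)).ext fun i => ?_, funext fun j => ?_⟩
  · simp [Fintype.linearCombination_apply, hx, Pi.single_apply]
  · exact (k j).2

/-- The multiplication `J ⊗ B → B` is injective for every right ideal `J`: given `∑ j_i b_i = 0`,
the matrix `p` moves across the tensor sign and kills the row `(j_i)`. Baer's criterion for `B⁺`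
follows. -/
theorem HasFreeFactorizations.isFlatLeftModule (hB : HasFreeFactorizations R B) :
    IsFlatLeftModule R B := by
  refine IsFlatLeftModule.of_baer fun J g => ?_
  let act : BalancedTensor R J B →+ B :=
    BalancedTensor.lift
      (AddMonoidHom.mk' (fun s => AddMonoidHom.mk' (fun b => (s : Rᵐᵒᵖ).unop • b)
        fun b b' => smul_add _ _ _)
        fun s s' => AddMonoidHom.ext fun b => add_smul _ _ _)
      fun s a b => mul_smul _ _ _
  have hact (s : J) (b : B) : act (BalancedTensor.tmul R s b) = (s : Rᵐᵒᵖ).unop • b := rfl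
  have hinj : Function.Injective act := by
    refine (injective_iff_map_eq_zero _).2 fun t ht => ?_
    obtain ⟨n, j, b, rfl⟩ := BalancedTensor.exists_sum t
    obtain ⟨m, p, y, hx, hp⟩ := hB n (Fintype.linearCombination R b)
      (fun i => (j i : Rᵐᵒᵖ).unop) (by simpa [hact, Fintype.linearCombination_apply] using ht)
    have hb (i : Fin n) : b i = ∑ l, p (Pi.single i 1) l • y (Pi.single l 1) := by
      rw [← LinearMap.apply_eq_sum_single, ← LinearMap.comp_apply, ← hx]
      simp [Fintype.linearCombination_apply, Pi.single_apply]
    have hj (l : Fin m) : ∑ i, MulOpposite.op (p (Pi.single i 1) l) • j i = 0 := by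
      refine Subtype.ext (MulOpposite.unop_injective ?_)
      have h := congrFun (p.apply_eq_sum_single (fun i => (j i : Rᵐᵒᵖ).unop)) l
      rw [hp] at h
      simpa using h.symm
    have h (i : Fin n) : BalancedTensor.tmul R (j i) (b i) = ∑ l, BalancedTensor.mk R J B
        (MulOpposite.op (p (Pi.single i 1) l) • j i) (y (Pi.single l 1)) := by
      rw [hb i, ← BalancedTensor.mk_apply, map_sum]
      exact Finset.sum_congr rfl fun l _ => (BalancedTensor.smul_tmul _ _ _).symm
    rw [Finset.sum_congr rfl fun i _ => h i, Finset.sum_comm]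
    refine Finset.sum_eq_zero fun l _ => ?_
    rw [← AddMonoidHom.finsetSum_apply, ← map_sum, hj, map_zero, AddMonoidHom.zero_apply]
  -- The extended character `c` of `B` satisfies `g s = s • c` on `J`.
  obtain ⟨c, hc⟩ := CharacterModule.exists_extension act hinj (BalancedTensor.uncurry g)
  refine ⟨LinearMap.toSpanSingleton Rᵐᵒᵖ _ c, fun s hs => CharacterModule.ext _ fun b => ?_⟩
  exact hc (BalancedTensor.tmul R (⟨s, hs⟩ : J) b)

/-- Relations are killed one at a time, each new factorization being applied to the current `y` and
the image `p r`. -/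
theorem HasFreeFactorizations.of_finset (hB : HasFreeFactorizations R B) {n : ℕ}
    (x : (Fin n → R) →ₗ[R] B) (s : Finset (Fin n → R)) (hs : ∀ r ∈ s, x r = 0) :
    ∃ (m : ℕ) (p : (Fin n → R) →ₗ[R] (Fin m → R)) (y : (Fin m → R) →ₗ[R] B),
      x = y ∘ₗ p ∧ ∀ r ∈ s, p r = 0 := by
  classical
  induction s using Finset.induction_on with
  | empty => exact ⟨n, LinearMap.id, x, rfl, by simp⟩
  | insert r s _ ih =>
    obtain ⟨m, p, y, rfl, hp⟩ := ih fun r hr => hs r (Finset.mem_insert_of_mem hr)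
    obtain ⟨m', p', y', rfl, hp'⟩ := hB m y (p r) (hs r (Finset.mem_insert_self _ _))
    refine ⟨m', p' ∘ₗ p, y', rfl, fun r' hr' => ?_⟩
    rcases Finset.mem_insert.1 hr' with rfl | h
    · exact hp'
    · rw [LinearMap.comp_apply, hp r' h, map_zero]

/-- A finitely presented flat module is projective. -/
theorem IsFlatLeftModule.projective (hB : IsFlatLeftModule R B) [Module.FinitePresentation R B] :
    Module.Projective R B := by
  obtain ⟨n, x, hx⟩ := Module.Finite.exists_fin' R B
  obtain ⟨s, hs⟩ := Module.FinitePresentation.fg_ker x hx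
  obtain ⟨m, p, y, hxy, hp⟩ := hB.hasFreeFactorizations.of_finset x s fun r hr => by
    rw [← LinearMap.mem_ker, ← hs]; exact Submodule.subset_span hr
  have hker : LinearMap.ker x ≤ LinearMap.ker p := by
    rw [← hs, Submodule.span_le]; exact hp
  -- All relations die under `p`, which therefore descends to `q` on `B`. Then `y ∘ q = id`.
  obtain ⟨q, hq⟩ : ∃ q : B →ₗ[R] (Fin m → R), q ∘ₗ x = p :=
    ⟨(LinearMap.ker x).liftQ p hker ∘ₗ (x.quotKerEquivOfSurjective hx).symm.toLinearMap,
      LinearMap.ext fun v => by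
        have : (x.quotKerEquivOfSurjective hx).symm (x v) = Submodule.Quotient.mk v :=
          (LinearEquiv.symm_apply_eq _).2 rfl
        simp [this]⟩
  refine Module.Projective.of_split q y (LinearMap.ext fun b => ?_)
  obtain ⟨v, rfl⟩ := hx b
  rw [LinearMap.comp_apply, ← LinearMap.comp_apply q, hq, ← LinearMap.comp_apply, ← hxy]
  rfl

theorem isFlatLeftModule_self : IsFlatLeftModule R R := by
  refine HasFreeFactorizations.isFlatLeftModule fun n x r hr =>
    ⟨1, LinearMap.pi fun _ => x, LinearMap.proj 0, rfl, funext fun _ => hr⟩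

end Equational

/-! ### Semi-hereditary rings -/

section Semihereditary

variable {R : Type u} [Ring R]

theorem IsLeftSemihereditary.isLeftCoherent (hR : IsLeftSemihereditary R) : IsLeftCoherent R := by
  intro I hI
  have := hR I hI
  have := Module.Finite.iff_fg.2 hI
  exact Module.finitePresentation_of_projective R I

theorem IsLeftSemihereditary.projective_of_injective_pi (hR : IsLeftSemihereditary R) (n : ℕ)
    {P : Type*} [AddCommGroup P] [Module R P] [Module.Finite R P] (f : P →ₗ[R] (Fin n → R))
    (hf : Function.Injective f) : Module.Projective R P := by
  induction n generalizing P with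
  | zero =>
    have := hf.subsingleton
    infer_instance
  | succ n ih =>
    -- The image of the first coordinate is a finitely generated left ideal, so it splits off. The
    -- kernel is again finitely generated and embeds in the remaining `n` coordinates.
    let g : P →ₗ[R] R := LinearMap.proj 0 ∘ₗ f
    have : Module.Projective R (LinearMap.range g) :=
      hR _ (Module.Finite.iff_fg.1 (Module.Finite.range g))
    obtain ⟨s, hs⟩ := LinearMap.exists_rightInverse_of_surjective g.rangeRestrict
      g.range_rangeRestrict
    have htfae := Function.Exact.split_tfae (LinearMap.exact_subtype_ker_map g.rangeRestrict)
      (Submodule.subtype_injective _) g.surjective_rangeRestrict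
    obtain ⟨e, -, -⟩ := (htfae.out 0 2).1 (Exists.intro s hs)
    have : Module.Finite R (LinearMap.ker g.rangeRestrict) :=
      Module.Finite.of_surjective (LinearMap.fst R _ _ ∘ₗ e.toLinearMap)
        (Prod.fst_surjective.comp e.surjective)
    have : Module.Projective R (LinearMap.ker g.rangeRestrict) := by
      refine ih (LinearMap.funLeft R R Fin.succ ∘ₗ f ∘ₗ Submodule.subtype _) ?_
      refine (injective_iff_map_eq_zero _).2 fun v hv => ?_
      refine Subtype.ext (hf ?_)
      refine (funext fun i => ?_ : f v = 0).trans (map_zero f).symm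
      refine Fin.cases ?_ (fun i => congrFun hv i) i
      exact congrArg Subtype.val v.2
    exact Module.Projective.of_equiv e.symm

/-- Over a semi-hereditary ring, finitely generated submodules of projective modules are
projective. -/
theorem IsLeftSemihereditary.projective_of_injective (hR : IsLeftSemihereditary R)
    {P Q : Type*} [AddCommGroup P] [Module R P] [Module.Finite R P] [AddCommGroup Q] [Module R Q]
    [Module.Projective R Q] (f : P →ₗ[R] Q) (hf : Function.Injective f) :
    Module.Projective R P := by
  obtain ⟨i, hi⟩ := Module.projective_def'.1 ‹Module.Projective R Q›
  have hi' : Function.Injective i := fun a b h => by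
    simpa [h] using (LinearMap.congr_fun hi a).symm.trans
      ((congrArg (Finsupp.linearCombination R id) h).trans (LinearMap.congr_fun hi b))
  let h : P →ₗ[R] (Q →₀ R) := i ∘ₗ f
  have hh : Function.Injective h := hi'.comp hf
  classical
  obtain ⟨s, hs⟩ := Module.finite_def.1 ‹Module.Finite R P›
  -- The supports of finitely many generators confine `P` to a finite free summand.
  let S : Finset Q := s.biUnion fun v => (h v).support
  have hS (v : P) : h v ∈ Finsupp.supported R R (S : Set Q) := by
    have : (⊤ : Submodule R P) ≤ (Finsupp.supported R R (S : Set Q)).comap h := by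
      rw [← hs, Submodule.span_le]
      intro v hv
      exact Finset.coe_subset.2 (Finset.subset_biUnion_of_mem (fun v => (h v).support) hv)
    exact this trivial
  refine hR.projective_of_injective_pi S.card
    (LinearMap.funLeft R R (fun i => (S.equivFin.symm i : Q)) ∘ₗ Finsupp.lcoeFun ∘ₗ h) ?_
  refine (injective_iff_map_eq_zero _).2 fun v hv => ?_
  refine (injective_iff_map_eq_zero h).1 hh v (Finsupp.ext fun q => ?_)
  by_cases hq : q ∈ S
  · simpa using congrFun hv (S.equivFin ⟨q, hq⟩)
  · by_contra hne
    exact hq (hS v (Finsupp.mem_support_iff.2 hne))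

/-- Over a semi-hereditary ring, submodules of flat modules are flat. -/
theorem IsLeftSemihereditary.isFlatLeftModule_of_injective (hR : IsLeftSemihereditary R)
    {B F : Type u} [AddCommGroup B] [Module R B] [AddCommGroup F] [Module R F]
    (f : B →ₗ[R] F) (hf : Function.Injective f) (hF : IsFlatLeftModule R F) :
    IsFlatLeftModule R B := by
  refine HasFreeFactorizations.isFlatLeftModule fun n x r hr => ?_
  obtain ⟨m, p, y, hxy, hp⟩ := hF.hasFreeFactorizations n (f ∘ₗ x) r (by simp [hr])
  have : Module.Projective R (LinearMap.range p) :=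
    hR.projective_of_injective_pi m _ (LinearMap.range p).subtype_injective
  obtain ⟨s, hs⟩ := LinearMap.exists_rightInverse_of_surjective p.rangeRestrict
    p.range_rangeRestrict
  -- The image of `p` is projective, so `s` splits `p` onto it and `x` itself can serve as second
  -- factor: `f x s p = y p s p = y p = f x`, and `f` is injective.
  refine ⟨n, s ∘ₗ p.rangeRestrict, x, LinearMap.ext fun v => hf ?_, ?_⟩
  · have h : p (s (p.rangeRestrict v)) = p v :=
      congrArg Subtype.val (LinearMap.congr_fun hs (p.rangeRestrict v))
    have h' (w) : f (x w) = y (p w) := LinearMap.congr_fun hxy w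
    simp only [LinearMap.comp_apply, h', h]
  · rw [LinearMap.comp_apply, show p.rangeRestrict r = 0 from Subtype.ext hp, map_zero]

end Semihereditary

/-! ### Lifting morphisms from bounded complexes of projectives to exact complexes -/

section Lifting

variable {C : Type*} [Category C] [Abelian C]

theorem HomologicalComplex.Acyclic.exact_sc' {N : ChainComplex C ℤ} (hN : N.Acyclic) (i j k : ℤ)
    (hij : j + 1 = i) (hjk : k + 1 = j) : (N.sc' i j k).Exact :=
  (N.exactAt_iff' i j k ((ComplexShape.down ℤ).prev_eq' hij)
    ((ComplexShape.down ℤ).next_eq' hjk)).1 (hN j)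

/-- A morphism from a bounded complex of projective objects to an exact complex is null
homotopic. -/
theorem exists_nullHomotopy {P N : ChainComplex C ℤ} (f : P ⟶ N) [∀ n, Projective (P.X n)]
    (hN : N.Acyclic) (a b : ℤ) (hP : ∀ n, n < a ∨ b < n → Limits.IsZero (P.X n)) :
    ∃ s : ∀ i j, P.X i ⟶ N.X j, ∀ i j k, j + 1 = i → i + 1 = k →
      f.f i = P.d i j ≫ s j i + s i k ≫ N.d k i := by
  have partial_homotopy (m : ℕ) : ∃ s : ∀ i j, P.X i ⟶ N.X j, ∀ i j k, j + 1 = i → i + 1 = k →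
      i < a + m → f.f i = P.d i j ≫ s j i + s i k ≫ N.d k i := by
    induction m with
    | zero => exact ⟨fun _ _ => 0, fun i j k _ _ hi => (hP i (by omega)).eq_of_src _ _⟩
    | succ m ih =>
      obtain ⟨s, hs⟩ := ih
      obtain ⟨c, hc⟩ : ∃ c : ℤ, c = a + m := ⟨_, rfl⟩
      obtain ⟨e, he⟩ : ∃ e : ℤ, e + 1 = c := ⟨c - 1, by omega⟩
      -- The defect in degree `c` lands in cycles by the homotopy relation in degree `c - 1`;
      -- exactness of `N` and projectivity of `P_c` then produce the next component.
      have hu : (f.f c - P.d c e ≫ s e c) ≫ N.d c e = 0 := by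
        have h := hs e (e - 1) c (by omega) he (by omega)
        have h' : P.d c e ≫ s e c ≫ N.d c e = P.d c e ≫ f.f e := by
          rw [h, Preadditive.comp_add, P.d_comp_d_assoc, Limits.zero_comp, zero_add]
        rw [Preadditive.sub_comp, Category.assoc, h', f.comm, sub_self]
      have hex := hN.exact_sc' (c + 1) c e rfl he
      obtain ⟨t, ht⟩ : ∃ t : P.X c ⟶ N.X (c + 1), t ≫ N.d (c + 1) c = f.f c - P.d c e ≫ s e c :=
        ⟨hex.liftFromProjective _ hu, hex.liftFromProjective_comp _ hu⟩
      -- Only `s c (c + 1)` changes. The relations in degrees below `c` do not involve it.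
      refine ⟨Function.update s c (Function.update (s c) (c + 1) t), fun i j k hj hk hi => ?_⟩
      rw [Function.update_of_ne (by omega : j ≠ c)]
      by_cases hic : i = c
      · subst hic
        obtain rfl : j = e := by omega
        subst hk
        rw [Function.update_self, Function.update_self, ht, add_sub_cancel]
      · rw [Function.update_of_ne hic]
        exact hs i j k hj hk (by push_cast at hi; omega)
  obtain ⟨s, hs⟩ := partial_homotopy (b - a + 1).toNat
  refine ⟨s, fun i j k hj hk => ?_⟩
  by_cases hi : i < a + (b - a + 1).toNat
  · exact hs i j k hj hk hi
  · exact (hP i (by omega)).eq_of_src _ _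

/-- The components of a null homotopy need not commute with differentials, so they lift freely
through the epimorphisms `g_j`. The null homotopic map they define is automatically a chain map. -/
theorem exists_lift_of_projective_of_acyclic {P N B : ChainComplex C ℤ} (f : P ⟶ N)
    [∀ n, Projective (P.X n)] (hN : N.Acyclic) (a b : ℤ)
    (hP : ∀ n, n < a ∨ b < n → Limits.IsZero (P.X n)) (g : B ⟶ N) [Epi g] :
    ∃ h : P ⟶ B, h ≫ g = f := by
  obtain ⟨s, hs⟩ := exists_nullHomotopy f hN a b hP
  refine ⟨Homotopy.nullHomotopicMap' fun i j _ => Projective.factorThru (s i j) (g.f j), ?_⟩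
  rw [Homotopy.nullHomotopicMap'_comp]
  ext i
  rw [Homotopy.nullHomotopicMap'_f (k₂ := i + 1) (k₀ := i - 1) (by simp) (by simp),
    hs i (i - 1) (i + 1) (by omega) rfl, Projective.factorThru_comp, Projective.factorThru_comp]

end Lifting

/-! ### Quotient complexes -/

section Quotient

variable {R : Type u} [Ring R]

/-- The quotient of a complex by a family of submodules compatible with the differentials. -/
def quotientComplex (M : ChainComplex (ModuleCat.{u} R) ℤ) (L : ∀ n, Submodule R (M.X n))
    (hL : ∀ i j, L i ≤ (L j).comap (M.d i j).hom) : ChainComplex (ModuleCat.{u} R) ℤ where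
  X n := ModuleCat.of R (M.X n ⧸ L n)
  d i j := ModuleCat.ofHom ((L i).mapQ (L j) (M.d i j).hom (hL i j))
  shape i j h := by
    ext x
    simp [M.shape i j h]
  d_comp_d' i j k _ _ := by
    ext x
    have h : (M.d j k) ((M.d i j) x) = 0 := by
      rw [← ModuleCat.comp_apply, M.d_comp_d]; rfl
    exact congrArg (Submodule.Quotient.mk (p := L k)) h

/-- Over a semi-hereditary ring, a morphism from a finitely presented complex whose components
factor through projective modules factors through a bounded complex of projective modules. -/
theorem IsLeftSemihereditary.exists_projective_factorization (hR : IsLeftSemihereditary R)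
    {M N : ChainComplex (ModuleCat.{u} R) ℤ} (f : M ⟶ N) (hM : ∀ n, Module.Finite R (M.X n))
    (hf : ∀ n, ∃ (Q : Type u) (_ : AddCommGroup Q) (_ : Module R Q) (_ : Module.Projective R Q)
      (q : M.X n →ₗ[R] Q) (φ : Q →ₗ[R] N.X n), (f.f n).hom = φ ∘ₗ q) :
    ∃ (P : ChainComplex (ModuleCat.{u} R) ℤ) (p : M ⟶ P) (f' : P ⟶ N),
      (∀ n, Projective (P.X n)) ∧ (∀ n, Epi (p.f n)) ∧ p ≫ f' = f := by
  choose Q _ _ _ q φ hφ using hf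
  -- The kernels of the `q n` need not form a subcomplex; intersecting with the preimage of the
  -- kernel one degree lower repairs this. The quotient by `L n` embeds in `Q n × Q (n - 1)`, hence
  -- is projective.
  let L (n : ℤ) : Submodule R (M.X n) :=
    LinearMap.ker ((q n).prod (q (n - 1) ∘ₗ (M.d n (n - 1)).hom))
  have mem_L {n : ℤ} {x : M.X n} : x ∈ L n ↔ q n x = 0 ∧ q (n - 1) (M.d n (n - 1) x) = 0 := by
    simp [L]
  have hL (i j) : L i ≤ (L j).comap (M.d i j).hom := by
    intro x hx
    by_cases hij : j = i - 1
    · subst hij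
      refine mem_L.2 ⟨(mem_L.1 hx).2, ?_⟩
      have h : (M.d (i - 1) (i - 1 - 1)) ((M.d i (i - 1)) x) = 0 := by
        rw [← ModuleCat.comp_apply, M.d_comp_d]; rfl
      exact (congrArg _ h).trans (map_zero _)
    · have h : (M.d i j).hom x = 0 := by
        rw [M.shape i j (by simp; omega)]; rfl
      exact (congrArg (· ∈ L j) h).mpr (L j).zero_mem
  have hLf (n) : L n ≤ LinearMap.ker (f.f n).hom := fun x hx => by
    rw [LinearMap.mem_ker, hφ, LinearMap.comp_apply, (mem_L.1 hx).1, map_zero]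
  refine ⟨quotientComplex M L hL,
    { f := fun n => ModuleCat.ofHom (L n).mkQ
      comm' := fun i j _ => rfl },
    { f := fun n => ModuleCat.ofHom ((L n).liftQ (f.f n).hom (hLf n))
      comm' := fun i j _ => by
        ext x
        obtain ⟨x, rfl⟩ := (L i).mkQ_surjective x
        exact congrArg (fun u => u.hom x) (f.comm i j) },
    fun n => ?_, fun n => ?_, rfl⟩
  · have := hM n
    refine (IsProjective.iff_projective _).1 (hR.projective_of_injective
      ((L n).liftQ ((q n).prod (q (n - 1) ∘ₗ (M.d n (n - 1)).hom)) le_rfl) ?_)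
    exact LinearMap.ker_eq_bot.1 (Submodule.ker_liftQ_eq_bot' _ _ rfl)
  · exact (ModuleCat.epi_iff_surjective _).2 (L n).mkQ_surjective

theorem IsLeftSemihereditary.mem_subprojectivityDomain (hR : IsLeftSemihereditary R)
    {M N : ChainComplex (ModuleCat.{u} R) ℤ} (hM : IsFinitelyPresentedComplex M)
    (hN : N.Acyclic) (h : ∀ n : ℤ, N.X n ∈ subprojectivityDomain (M.X n)) :
    N ∈ subprojectivityDomain M := by
  intro B g _ f
  obtain ⟨⟨a, b, hab⟩, hfp⟩ := hM
  obtain ⟨P, p, f', hP, hp, rfl⟩ := hR.exists_projective_factorization f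
    (fun n => have := hfp n; inferInstance) fun n => by
      -- Lifting `f_n` through a free cover of `N_n` factors it through a projective.
      let φ : (N.X n →₀ R) →ₗ[R] N.X n := Finsupp.linearCombination R id
      have : Epi (ModuleCat.ofHom φ) :=
        (ModuleCat.epi_iff_surjective _).2 (Finsupp.linearCombination_id_surjective R _)
      obtain ⟨q, hq⟩ := h n (ModuleCat.ofHom φ) (f.f n)
      exact ⟨N.X n →₀ R, _, _, inferInstance, q.hom, φ, by rw [← hq]; rfl⟩
  obtain ⟨h, hh⟩ := exists_lift_of_projective_of_acyclic f' hN a b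
    (fun n hn => (hab n hn).of_epi (p.f n)) g
  exact ⟨p ≫ h, by rw [Category.assoc, hh]⟩

end Quotient

/-! ### Sphere complexes -/

section Sphere

variable {R : Type u} [Ring R]

theorem isFinitelyPresentedComplex_shiftedSphere (M : ModuleCat.{u} R)
    [Module.FinitePresentation R M] (n : ℤ) : IsFinitelyPresentedComplex (shiftedSphere M n) := by
  have hz (k : ℤ) (hk : k ≠ n) : Limits.IsZero ((shiftedSphere M n).X k) :=
    HomologicalComplex.isZero_single_obj_X _ _ _ _ hk
  refine ⟨⟨n, n, fun k hk => hz k (by omega)⟩, fun k => ?_⟩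
  by_cases hk : k = n
  · subst hk
    exact Module.FinitePresentation.of_equiv
      (HomologicalComplex.singleObjXSelf (ComplexShape.down ℤ) k M).toLinearEquiv.symm
  · have := ModuleCat.subsingleton_of_isZero (hz k hk)
    have : Module.Free R ((shiftedSphere M n).X k) := Module.Free.of_subsingleton R _
    have : Module.Projective R ((shiftedSphere M n).X k) := Module.Projective.of_free
    have : Module.Finite R ((shiftedSphere M n).X k) := Module.Finite.of_finite
    exact Module.finitePresentation_of_projective _ _

theorem mem_subprojectivityDomain_shiftedSphere_X {M : ModuleCat.{u} R}
    {N : ChainComplex (ModuleCat.{u} R) ℤ} {n : ℤ} (h : N.X n ∈ subprojectivityDomain M) (k : ℤ) :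
    N.X k ∈ subprojectivityDomain ((shiftedSphere M n).X k) := by
  intro B g _ f
  by_cases hk : k = n
  · subst hk
    let e := HomologicalComplex.singleObjXSelf (ComplexShape.down ℤ) k M
    obtain ⟨u, hu⟩ := h g (e.inv ≫ f)
    exact ⟨e.hom ≫ u, by rw [Category.assoc, hu, e.hom_inv_id_assoc]⟩
  · exact ⟨0, (HomologicalComplex.isZero_single_obj_X _ _ _ _ hk).eq_of_src _ _⟩

end Sphere

/-! ### The complex of a filtration, and projective covers of complexes -/

section Filtration

variable {R : Type u} [Ring R]

/-- The exact complex with components `A n / A (n + 2)`, for a decreasing filtration `A`. -/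
def filtrationComplex {V : Type u} [AddCommGroup V] [Module R V] (A : ℤ → Submodule R V)
    (hA : Antitone A) : ChainComplex (ModuleCat.{u} R) ℤ where
  X n := ModuleCat.of R (A n ⧸ (A (n + 2)).submoduleOf (A n))
  d i j := if h : j + 1 = i then
      ModuleCat.ofHom (((A (i + 2)).submoduleOf (A i)).mapQ ((A (j + 2)).submoduleOf (A j))
        (Submodule.inclusion (hA (by omega))) fun x hx => hA (by omega : j + 2 ≤ i + 2) hx)
    else 0
  shape i j h := dif_neg h
  d_comp_d' i j k h h' := by
    have h1 : j + 1 = i := h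
    have h2 : k + 1 = j := h'
    rw [dif_pos h1, dif_pos h2]
    ext x
    exact (Submodule.Quotient.mk_eq_zero _).2 (hA (by omega : k + 2 ≤ i) x.2)

variable {V : Type u} [AddCommGroup V] [Module R V] (A : ℤ → Submodule R V) (hA : Antitone A)

theorem filtrationComplex_d_mk (i j : ℤ) (h : j + 1 = i) (x : A i) :
    (filtrationComplex A hA).d i j (Submodule.Quotient.mk x) =
      Submodule.Quotient.mk (Submodule.inclusion (hA (by omega)) x) := by
  simp only [filtrationComplex, dif_pos h]
  rfl

/-- A cycle in degree `j` is the class of some `x` in `A j` that lies in `A (j + 1)`, so the same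
`x` represents a preimage. -/
theorem filtrationComplex_acyclic : (filtrationComplex A hA).Acyclic := by
  intro j
  rw [HomologicalComplex.exactAt_iff' _ (j + 1) j (j - 1) (by simp) (by simp),
    ShortComplex.moduleCat_exact_iff]
  intro x hx
  obtain ⟨x, rfl⟩ := Submodule.mkQ_surjective _ x
  have h : (filtrationComplex A hA).d j (j - 1) (Submodule.Quotient.mk x) = 0 := hx
  rw [filtrationComplex_d_mk A hA _ _ (by omega)] at h
  have h' : (x : V) ∈ A (j + 1) := by
    have : (x : V) ∈ A (j - 1 + 2) := 
      (Submodule.Quotient.mk_eq_zero ((A (j - 1 + 2)).submoduleOf (A (j - 1)))).1 h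
    rwa [show j - 1 + 2 = j + 1 by ring] at this
  exact ⟨Submodule.Quotient.mk ⟨x, h'⟩, filtrationComplex_d_mk A hA _ _ rfl _⟩

variable (R) in
/-- The contractible complex with all components `Q × Q` and differential `(x, y) ↦ (y, 0)`. -/
def pathComplex (Q : Type u) [AddCommGroup Q] [Module R Q] :
    ChainComplex (ModuleCat.{u} R) ℤ where
  X _ := ModuleCat.of R (Q × Q)
  d i j := if j + 1 = i then ModuleCat.ofHom (LinearMap.inl R Q Q ∘ₗ LinearMap.snd R Q Q) else 0
  shape i j h := if_neg h
  d_comp_d' i j k h h' := by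
    have h1 : j + 1 = i := h
    have h2 : k + 1 = j := h'
    rw [if_pos h1, if_pos h2]
    rfl

theorem pathComplex_d_apply {Q : Type u} [AddCommGroup Q] [Module R Q] (i j : ℤ) (h : j + 1 = i)
    (x : Q × Q) : (pathComplex R Q).d i j x = (x.2, (0 : Q)) := by
  simp only [pathComplex, if_pos h]
  rfl

/-- The morphism from the path complex given by a family of homomorphisms `Q → N_n`. -/
def pathComplexDesc {Q : Type u} [AddCommGroup Q] [Module R Q]
    {N : ChainComplex (ModuleCat.{u} R) ℤ} (q : ∀ n, Q →ₗ[R] N.X n) : pathComplex R Q ⟶ N where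
  f n := ModuleCat.ofHom (((N.d (n + 1) n).hom ∘ₗ q (n + 1)).coprod (q n))
  comm' i j h := by
    obtain rfl : j + 1 = i := h
    refine ModuleCat.hom_ext (LinearMap.ext fun x => ?_)
    obtain ⟨x, y⟩ : Q × Q := x
    refine Eq.trans ?_ (congrArg (((N.d (j + 1) j).hom ∘ₗ q (j + 1)).coprod (q j))
      (pathComplex_d_apply (j + 1) j rfl (x, y))).symm
    change N.d (j + 1) j (N.d (j + 1 + 1) (j + 1) (q (j + 1 + 1) x) + q (j + 1) y) =
      N.d (j + 1) j (q (j + 1) y) + q j 0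
    have hd : N.d (j + 1) j (N.d (j + 1 + 1) (j + 1) (q (j + 1 + 1) x)) = 0 := by
      rw [← ModuleCat.comp_apply, N.d_comp_d]; rfl
    rw [map_add, hd, map_zero, zero_add, add_zero]

/-- A single `Q` covers all degrees, as the components of `pathComplex` do not vary. -/
theorem exists_projective_surjective_family (N : ℤ → ModuleCat.{u} R) :
    ∃ (Q : Type u) (_ : AddCommGroup Q) (_ : Module R Q) (_ : Module.Projective R Q)
      (q : ∀ n, Q →ₗ[R] N n), ∀ n, Function.Surjective (q n) :=
  ⟨Π₀ n : ℤ, (N n →₀ R), inferInstance, inferInstance, inferInstance,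
    fun n => Finsupp.linearCombination R id ∘ₗ DFinsupp.lapply n,
    fun n => (Finsupp.linearCombination_id_surjective R _).comp
      (fun x => ⟨DFinsupp.single n x, DFinsupp.single_eq_same⟩)⟩

/-- If spheres on a finitely generated ideal `I` lift against all exact complexes whose component
in the degree of the sphere is projective, then `I` is projective. -/
theorem Ideal.projective_of_mem_subprojectivityDomain (I : Ideal R)
    (h : ∀ N : ChainComplex (ModuleCat.{u} R) ℤ, N.Acyclic → Projective (N.X 0) →
      N ∈ subprojectivityDomain (shiftedSphere (ModuleCat.of R I) 0)) :
    Module.Projective R I := by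
  -- The associated complex is `0 → I → R → R/I → 0`, in degrees 1, 0 and -1.
  let A (n : ℤ) : Submodule R R := if n ≤ 0 then ⊤ else if n ≤ 1 then I else ⊥
  have hA : Antitone A := by
    intro m n hmn
    simp only [A]
    split_ifs <;> first | omega | simp
  have hA0 : A 0 = ⊤ := if_pos le_rfl
  have hA1 : A 1 = I := by simp [A]
  have hA2 : A 2 = ⊥ := by simp [A]
  let N := filtrationComplex A hA
  have hproj : Projective (N.X 0) := by
    refine (IsProjective.iff_projective (R := R) (A 0 ⧸ (A (0 + 2)).submoduleOf (A 0))).1 ?_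
    have hbot : (A (0 + 2)).submoduleOf (A 0) = ⊥ := by
      rw [zero_add, hA2, Submodule.submoduleOf, Submodule.comap_bot, Submodule.ker_subtype]
    exact Module.Projective.of_equiv
      ((LinearEquiv.ofTop _ hA0).symm ≪≫ₗ (Submodule.quotEquivOfEqBot _ hbot).symm)
  let e : N.X 0 →ₗ[R] R := ((A (0 + 2)).submoduleOf (A 0)).liftQ (A 0).subtype fun x hx => by
    have hx' : (x : R) ∈ A (0 + 2) := hx
    rwa [zero_add, hA2] at hx'
  let φ : ModuleCat.of R I ⟶ N.X 0 := ModuleCat.ofHom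
    (Submodule.mkQ _ ∘ₗ Submodule.inclusion (hA0 ▸ le_top : I ≤ A 0))
  have hφ (k : ℤ) (hk : (ComplexShape.down ℤ).Rel 0 k) : φ ≫ N.d 0 k = 0 := by
    have hk' : k + 1 = 0 := hk
    ext x
    refine (filtrationComplex_d_mk A hA _ _ hk' _).trans ?_
    refine (Submodule.Quotient.mk_eq_zero _).2 ?_
    change (x : R) ∈ A (k + 2)
    rw [show k + 2 = 1 by omega, hA1]
    exact x.2
  obtain ⟨Q, _, _, _, q, hq⟩ := exists_projective_surjective_family (R := R) N.X
  have hepi : Epi (pathComplexDesc q) := by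
    refine HomologicalComplex.epi_of_epi_f _ fun n => (ModuleCat.epi_iff_surjective _).2 fun y => ?_
    obtain ⟨x, rfl⟩ := hq n y
    refine ⟨((0 : Q), x), ?_⟩
    change ((N.d (n + 1) n).hom ∘ₗ q (n + 1)).coprod (q n) (0, x) = q n x
    simp
  obtain ⟨l, hl⟩ := h N (filtrationComplex_acyclic A hA) hproj (pathComplexDesc q)
    (HomologicalComplex.mkHomFromSingle φ hφ)
  let u : ModuleCat.of R I ⟶ (pathComplex R Q).X 0 :=
    (HomologicalComplex.singleObjXSelf (ComplexShape.down ℤ) 0 (ModuleCat.of R I)).inv ≫ l.f 0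
  have hu : u ≫ (pathComplexDesc q).f 0 = φ := by
    have := congrArg (fun v => v.f 0) hl
    simp only [HomologicalComplex.comp_f, HomologicalComplex.mkHomFromSingle_f] at this
    simp [u, this]
  have hud : u ≫ (pathComplex R Q).d 0 (-1) = 0 := by simp [u]
  let v : I →ₗ[R] Q × Q := u.hom
  -- The lift takes values in cycles of the path complex, which are the pairs `(w, 0)`.
  have hv (x : I) : (v x).2 = 0 := by
    have := (pathComplex_d_apply 0 (-1) (by simp) (v x)).symm.trans
      (congrArg (fun w => w.hom x) hud)
    exact congrArg Prod.fst this
  have hed (y : N.X 1) : e (N.d 1 0 y) ∈ I := by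
    obtain ⟨y, rfl⟩ := Submodule.mkQ_surjective _ y
    have h := congrArg e (filtrationComplex_d_mk A hA 1 0 (by simp) y)
    refine (congrArg (· ∈ I) h).mpr ?_
    change (y : R) ∈ I
    rw [← hA1]
    exact y.2
  -- On pairs `(w, 0)` the cover is `d ∘ q 1`, so `q 1`, read as a map `Q → I`, retracts the first
  -- component of the lift.
  refine Module.Projective.of_split (LinearMap.fst R Q Q ∘ₗ v)
    (LinearMap.codRestrict I (e ∘ₗ (N.d 1 0).hom ∘ₗ q 1) fun x => hed (q 1 x))
    (LinearMap.ext fun x => Subtype.ext ?_)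
  have hx : N.d 1 0 (q 1 (v x).1) + q 0 (v x).2 = φ x := congrArg (fun w => w.hom x) hu
  rw [hv, map_zero, add_zero] at hx
  exact congrArg e hx

end Filtration

/-! ### Exactness of tensor product complexes -/

section TensorExact

theorem DirectSum.exact_map {ι : Type*} {α β γ : ι → Type*} [∀ i, AddCommGroup (α i)]
    [∀ i, AddCommGroup (β i)] [∀ i, AddCommGroup (γ i)] (f : ∀ i, α i →+ β i)
    (g : ∀ i, β i →+ γ i) (h : ∀ i, Function.Exact (f i) (g i)) :
    Function.Exact (DirectSum.map f) (DirectSum.map g) := by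
  classical
  intro x
  constructor
  · intro hx
    have hx' (i) : g i (x i) = 0 := by rw [← DirectSum.map_apply, hx, DirectSum.zero_apply]
    choose y hy using fun i => (h i (x i)).1 (hx' i)
    refine ⟨∑ i ∈ x.support, DirectSum.of α i (y i), ?_⟩
    simp only [map_sum, DirectSum.map_of, hy, DirectSum.sum_support_of]
  · rintro ⟨y, rfl⟩
    ext i
    rw [DirectSum.map_apply, DirectSum.map_apply, (h i).apply_apply_eq_zero, DirectSum.zero_apply]

variable {R : Type u} [Ring R] (E : ChainComplex (ModuleCat.{u} Rᵐᵒᵖ) ℤ)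
  {F F' F'' : ChainComplex (ModuleCat.{u} R) ℤ}

/-- The inclusion of `E_i ⊗_R F_j` in the tensor product of complexes. -/
def tensorOf (E : ChainComplex (ModuleCat.{u} Rᵐᵒᵖ) ℤ) (F : ChainComplex (ModuleCat.{u} R) ℤ)
    (n i j : ℤ) (h : i + j = n) : BalancedTensor R (E.X i) (F.X j) →+ TensorDeg E F n :=
  DirectSum.of (fun q : {q : ℤ × ℤ // q.1 + q.2 = n} =>
    BalancedTensor R (E.X q.1.1) (F.X q.1.2)) ⟨(i, j), h⟩

theorem tensorDiff_tensorOf (n m i j k l : ℤ) (hnm : m + 1 = n) (hk : k + l = n) (hi : i + 1 = k)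
    (hj : j + 1 = l) (y : BalancedTensor R (E.X k) (F.X l)) :
    tensorDiff E F n m hnm (tensorOf E F n k l hk y) =
      tensorOf E F m i l (by omega) (BalancedTensor.map (E.d k i).hom LinearMap.id y) +
        ((k.negOnePow : ℤˣ) : ℤ) • tensorOf E F m k j (by omega)
          (BalancedTensor.map LinearMap.id (F.d l j).hom y) := by
  obtain rfl : i = k - 1 := by omega
  obtain rfl : j = l - 1 := by omega
  rw [tensorDiff, tensorOf, DirectSum.toAddMonoid_of]
  rfl

theorem tensorDeg_hom_ext {n : ℤ} {A : Type*} [AddCommGroup A] {f g : TensorDeg E F n →+ A}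
    (h : ∀ i j hij x, f (tensorOf E F n i j hij x) = g (tensorOf E F n i j hij x)) : f = g :=
  DirectSum.addHom_ext fun p x => h p.1.1 p.1.2 p.2 x

theorem tensorComplex_acyclic_iff :
    (tensorComplex E F).Acyclic ↔ ∀ (k n m : ℤ) (hk : n + 1 = k) (hm : m + 1 = n)
      (x : TensorDeg E F n), tensorDiff E F n m hm x = 0 →
        ∃ y, tensorDiff E F k n hk y = x := by
  have key (k n m : ℤ) (hk : n + 1 = k) (hm : m + 1 = n) : (tensorComplex E F).ExactAt n ↔
      ∀ x : TensorDeg E F n, tensorDiff E F n m hm x = 0 → ∃ y, tensorDiff E F k n hk y = x := by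
    rw [HomologicalComplex.exactAt_iff' _ k n m ((ComplexShape.down ℤ).prev_eq' hk)
      ((ComplexShape.down ℤ).next_eq' hm), ShortComplex.ab_exact_iff]
    have h1 : (tensorComplex E F).d k n = AddCommGrpCat.ofHom (tensorDiff E F k n hk) :=
      dif_pos hk
    have h2 : (tensorComplex E F).d n m = AddCommGrpCat.ofHom (tensorDiff E F n m hm) :=
      dif_pos hm
    change (∀ x : TensorDeg E F n, ((tensorComplex E F).d n m).hom x = 0 →
      ∃ y : TensorDeg E F k, ((tensorComplex E F).d k n).hom y = x) ↔ _
    rw [h1, h2]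
    rfl
  exact ⟨fun h k n m hk hm => (key k n m hk hm).1 (h n),
    fun h n => (key (n + 1) n (n - 1) rfl (by omega)).2 (h _ _ _ _ _)⟩

/-- The components of the morphism `E ⊗ F ⟶ E ⊗ F'` induced by a morphism `F ⟶ F'`. -/
def tensorDegMap (φ : F ⟶ F') (n : ℤ) : TensorDeg E F n →+ TensorDeg E F' n :=
  DirectSum.map fun p : {p : ℤ × ℤ // p.1 + p.2 = n} =>
    BalancedTensor.map (LinearMap.id : E.X p.1.1 →ₗ[Rᵐᵒᵖ] E.X p.1.1) (φ.f p.1.2).hom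

theorem tensorDegMap_tensorOf (φ : F ⟶ F') (n i j : ℤ) (h : i + j = n)
    (x : BalancedTensor R (E.X i) (F.X j)) :
    tensorDegMap E φ n (tensorOf E F n i j h x) =
      tensorOf E F' n i j h (BalancedTensor.map LinearMap.id (φ.f j).hom x) :=
  DirectSum.map_of _ _ _

theorem tensorDiff_comp_tensorDegMap (φ : F ⟶ F') (n m : ℤ) (h : m + 1 = n) :
    (tensorDiff E F' n m h).comp (tensorDegMap E φ n) =
      (tensorDegMap E φ m).comp (tensorDiff E F n m h) := by
  refine tensorDeg_hom_ext E fun i j hij x => ?_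
  have hcomm : (F'.d j (j - 1)).hom ∘ₗ (φ.f j).hom = (φ.f (j - 1)).hom ∘ₗ (F.d j (j - 1)).hom :=
    congrArg ModuleCat.Hom.hom (φ.comm j (j - 1))
  rw [AddMonoidHom.comp_apply, AddMonoidHom.comp_apply, tensorDegMap_tensorOf,
    tensorDiff_tensorOf E n m (i - 1) (j - 1) i j h hij (by omega) (by omega),
    tensorDiff_tensorOf E n m (i - 1) (j - 1) i j h hij (by omega) (by omega), map_add,
    map_zsmul, tensorDegMap_tensorOf, tensorDegMap_tensorOf]
  simp only [BalancedTensor.map_map, LinearMap.id_comp, LinearMap.comp_id, hcomm]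

/-- Functoriality of the tensor product of complexes in the second variable. -/
noncomputable def tensorComplexMap (φ : F ⟶ F') : tensorComplex E F ⟶ tensorComplex E F' where
  f n := AddCommGrpCat.ofHom (tensorDegMap E φ n)
  comm' n m h := by
    have h' : m + 1 = n := h
    have h1 : (tensorComplex E F).d n m = AddCommGrpCat.ofHom (tensorDiff E F n m h') :=
      dif_pos h'
    have h2 : (tensorComplex E F').d n m = AddCommGrpCat.ofHom (tensorDiff E F' n m h') :=
      dif_pos h'
    rw [h1, h2]
    exact congrArg AddCommGrpCat.ofHom (tensorDiff_comp_tensorDegMap E φ n m h')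

theorem tensorComplexMap_comp_eq_zero (φ : F ⟶ F') (ψ : F' ⟶ F'') (h : φ ≫ ψ = 0) :
    tensorComplexMap E φ ≫ tensorComplexMap E ψ = 0 := by
  have h' (j) : (ψ.f j).hom ∘ₗ (φ.f j).hom = 0 := by
    rw [← ModuleCat.hom_comp, ← HomologicalComplex.comp_f, h]; rfl
  refine HomologicalComplex.hom_ext _ _ fun n => congrArg AddCommGrpCat.ofHom
    (?_ : (tensorDegMap E ψ n).comp (tensorDegMap E φ n) = 0)
  refine tensorDeg_hom_ext E fun i j hij x => ?_
  rw [AddMonoidHom.comp_apply, tensorDegMap_tensorOf, tensorDegMap_tensorOf,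
    BalancedTensor.map_map, h', BalancedTensor.map_zero_right, AddMonoidHom.zero_apply, map_zero,
    AddMonoidHom.zero_apply]

/-- Tensoring an exact complex with a complex of flat modules with zero differentials yields an
exact complex. -/
theorem tensorComplex_acyclic_of_d_eq_zero (hE : E.Acyclic) (hF : ∀ n, IsFlatLeftModule R (F.X n))
    (hd : ∀ i j, F.d i j = 0) : (tensorComplex E F).Acyclic := by
  classical
  have hdiff (n m i j k : ℤ) (hm : m + 1 = n) (hk : k + j = n) (hi : i + 1 = k)
      (x : BalancedTensor R (E.X k) (F.X j)) :
      tensorDiff E F n m hm (tensorOf E F n k j hk x) =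
        tensorOf E F m i j (by omega) (BalancedTensor.map (E.d k i).hom LinearMap.id x) := by
    rw [tensorDiff_tensorOf E n m i (j - 1) k j hm hk hi (by omega), hd, ModuleCat.hom_zero,
      BalancedTensor.map_zero_right, AddMonoidHom.zero_apply, map_zero, smul_zero, add_zero]
  rw [tensorComplex_acyclic_iff]
  intro k n m hk hm x hx
  -- With zero differential on `F`, the total differential preserves the index `j`. Thus each
  -- component of a cycle is a cycle of some `E ⊗ F_j`, where flatness of `F_j` applies.
  have hcomp (i j l : ℤ) (hl : l + j = n) (hi : i + 1 = l) :
      (tensorDiff E F n m hm x) ⟨(i, j), by simp only; omega⟩ =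
        BalancedTensor.map (E.d l i).hom LinearMap.id (x ⟨(l, j), hl⟩) := by
    refine DFunLike.congr_fun (f := (DFinsupp.evalAddMonoidHom
      (⟨(i, j), by simp only; omega⟩ : {q : ℤ × ℤ // q.1 + q.2 = m})).comp
        (tensorDiff E F n m hm)) (g := (BalancedTensor.map (E.d l i).hom LinearMap.id).comp
          (DFinsupp.evalAddMonoidHom
            (⟨(l, j), hl⟩ : {q : ℤ × ℤ // q.1 + q.2 = n}))) ?_ x
    refine tensorDeg_hom_ext E fun a b hab y => ?_
    change (tensorDiff E F n m hm (tensorOf E F n a b hab y)) ⟨(i, j), _⟩ =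
      BalancedTensor.map (E.d l i).hom LinearMap.id ((tensorOf E F n a b hab y) ⟨(l, j), hl⟩)
    by_cases hbj : b = j
    · subst hbj
      obtain rfl : a = l := by omega
      rw [hdiff n m i b a hm hab hi, tensorOf, tensorOf, DirectSum.of_eq_same,
        DirectSum.of_eq_same]
    · rw [hdiff n m (a - 1) b a hm hab (by omega), tensorOf, tensorOf, DirectSum.of_eq_of_ne,
        DirectSum.of_eq_of_ne, map_zero]
      · exact fun h => hbj (congrArg (fun q => q.1.2) h).symm
      · exact fun h => hbj (congrArg (fun q => q.1.2) h).symm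
  have hex (p : {p : ℤ × ℤ // p.1 + p.2 = n}) :
      ∃ y : BalancedTensor R (E.X (p.1.1 + 1)) (F.X p.1.2),
        BalancedTensor.map (E.d (p.1.1 + 1) p.1.1).hom LinearMap.id y = x p := by
    have hE' := hE.exact_sc' (p.1.1 + 1) p.1.1 (p.1.1 - 1) rfl (by omega)
    have hexact : Function.Exact (E.d (p.1.1 + 1) p.1.1).hom (E.d p.1.1 (p.1.1 - 1)).hom :=
      (ShortComplex.ShortExact.moduleCat_exact_iff_function_exact _).1 hE'
    refine ((hF p.1.2).exact_map _ _ hexact (x p)).1 ?_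
    have h := hcomp (p.1.1 - 1) p.1.2 p.1.1 p.2 (by omega)
    rw [hx] at h
    exact h.symm
  choose y hy using hex
  refine ⟨∑ p ∈ x.support, tensorOf E F k (p.1.1 + 1) p.1.2 (by have := p.2; omega) (y p), ?_⟩
  have hterm (p : {p : ℤ × ℤ // p.1 + p.2 = n}) : tensorDiff E F k n hk
      (tensorOf E F k (p.1.1 + 1) p.1.2 (by have := p.2; omega) (y p)) =
        DirectSum.of (fun q : {q : ℤ × ℤ // q.1 + q.2 = n} =>
          BalancedTensor R (E.X q.1.1) (F.X q.1.2)) p (x p) := by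
    rw [hdiff k n p.1.1 p.1.2 (p.1.1 + 1) hk _ rfl, hy]
    rfl
  rw [map_sum, Finset.sum_congr rfl fun p _ => hterm p, DirectSum.sum_support_of]

/-- The complex with zero differentials and the given components. -/
def zeroDiffComplex (X : ℤ → ModuleCat.{u} R) : ChainComplex (ModuleCat.{u} R) ℤ where
  X := X
  d _ _ := 0

theorem zeroDiffComplex_isDGFlat (X : ℤ → ModuleCat.{u} R) (hX : ∀ n, IsFlatLeftModule R (X n)) :
    IsDGFlat (zeroDiffComplex X) :=
  ⟨hX, fun E hE => tensorComplex_acyclic_of_d_eq_zero E hE hX fun _ _ => rfl⟩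

/-- A complex with flat cycles and flat boundaries stays exact under tensoring with exact
complexes. -/
theorem tensorComplex_acyclic_of_flat_cycles (hE : E.Acyclic)
    (hZ : ∀ n, IsFlatLeftModule R (LinearMap.ker (F.d n (n - 1)).hom))
    (hB : ∀ n, IsFlatLeftModule R (LinearMap.range (F.d n (n - 1)).hom)) :
    (tensorComplex E F).Acyclic := by
  let Z : ChainComplex (ModuleCat.{u} R) ℤ :=
    zeroDiffComplex fun n => ModuleCat.of R (LinearMap.ker (F.d n (n - 1)).hom)
  -- The boundaries in `F_(n-1)` are placed in degree `n`, so that `d` induces a chain map `F ⟶ B`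
  -- without a shift.
  let B : ChainComplex (ModuleCat.{u} R) ℤ :=
    zeroDiffComplex fun n => ModuleCat.of R (LinearMap.range (F.d n (n - 1)).hom)
  let ι : Z ⟶ F :=
    { f := fun n => ModuleCat.ofHom (LinearMap.ker (F.d n (n - 1)).hom).subtype
      comm' := fun i j hij => by
        have hij' : j + 1 = i := hij
        obtain rfl : j = i - 1 := by omega
        ext x
        exact x.2 }
  let π : F ⟶ B :=
    { f := fun n => ModuleCat.ofHom (F.d n (n - 1)).hom.rangeRestrict
      comm' := fun i j _ => by
        ext x
        refine Subtype.ext (Eq.symm ?_)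
        change F.d j (j - 1) (F.d i j x) = 0
        rw [← ModuleCat.comp_apply, F.d_comp_d]
        rfl }
  have hex (n) : Function.Exact (ι.f n).hom (π.f n).hom := fun x =>
    ⟨fun h => ⟨⟨x, congrArg Subtype.val h⟩, rfl⟩, fun ⟨y, hy⟩ => Subtype.ext (hy ▸ y.2)⟩
  have hsurj (n) : Function.Surjective (π.f n).hom := LinearMap.surjective_rangeRestrict _
  have hinj (n) : Function.Injective (ι.f n).hom := Submodule.subtype_injective _
  have hιπ : ι ≫ π = 0 := by
    ext n x
    exact (hex n).apply_apply_eq_zero x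
  let S : ShortComplex (ChainComplex AddCommGrpCat.{u} ℤ) :=
    ShortComplex.mk (tensorComplexMap E ι) (tensorComplexMap E π)
      (tensorComplexMap_comp_eq_zero E ι π hιπ)
  have hS : S.ShortExact := by
    refine HomologicalComplex.shortExact_of_degreewise_shortExact S fun n => ?_
    exact
      { exact := (ShortComplex.ab_exact_iff_function_exact _).2 (DirectSum.exact_map _ _ fun p =>
          BalancedTensor.exact_map_right _ _ (hex p.1.2) (hsurj p.1.2))
        -- Flatness of the boundaries makes the sequence pure, so it stays exact on the left for
        -- every `E_i`.
        mono_f := (AddCommGrpCat.mono_iff_injective _).2 ((DirectSum.map_injective _).2 fun p =>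
          (hB p.1.2).map_injective _ _ (hinj p.1.2) (hex p.1.2) (hsurj p.1.2))
        epi_g := (AddCommGrpCat.epi_iff_surjective _).2 ((DirectSum.map_surjective _).2 fun p =>
          BalancedTensor.map_surjective _ _ Function.surjective_id (hsurj p.1.2)) }
  have hZ' : S.X₁.Acyclic := tensorComplex_acyclic_of_d_eq_zero E hE hZ fun _ _ => rfl
  have hB' : S.X₃.Acyclic := tensorComplex_acyclic_of_d_eq_zero E hE hB fun _ _ => rfl
  intro n
  rw [HomologicalComplex.exactAt_iff_isZero_homology]
  -- The homology of the middle term sits between two zero groups in the long exact sequence.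
  exact (hS.homology_exact₂ n).isZero_X₂
    (((S.X₁.exactAt_iff_isZero_homology n).1 (hZ' n)).eq_of_src _ _)
    (((S.X₃.exactAt_iff_isZero_homology n).1 (hB' n)).eq_of_tgt _ _)

/-- Cycles and boundaries are submodules of the flat components, hence flat. -/
theorem IsLeftSemihereditary.isDGFlat_of_flat (hR : IsLeftSemihereditary R)
    (hF : ∀ n, IsFlatLeftModule R (F.X n)) : IsDGFlat F :=
  ⟨hF, fun E hE => tensorComplex_acyclic_of_flat_cycles E hE
    (fun n => hR.isFlatLeftModule_of_injective _ (Submodule.subtype_injective _) (hF n))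
    (fun n => hR.isFlatLeftModule_of_injective _ (Submodule.subtype_injective _) (hF (n - 1)))⟩

end TensorExact

/-! ### The equivalence of the four conditions -/

theorem corollary4p3 (R : Type u) [Ring R] :
    List.TFAE [
      IsLeftSemihereditary R,
      IsLeftCoherent R ∧
        ∀ M N : ChainComplex (ModuleCat.{u} R) ℤ,
          IsFinitelyPresentedComplex M → N.Acyclic →
            (∀ n : ℤ, N.X n ∈ subprojectivityDomain (M.X n)) → N ∈ subprojectivityDomain M,
      IsLeftCoherent R ∧
        ∀ (M : ModuleCat.{u} R) (N : ChainComplex (ModuleCat.{u} R) ℤ),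
          Module.FinitePresentation R M → N.Acyclic →
            ∀ n : ℤ, N.X n ∈ subprojectivityDomain M →
              N ∈ subprojectivityDomain (shiftedSphere M n),
      IsLeftCoherent R ∧
        ∀ (F N : ChainComplex (ModuleCat.{u} R) ℤ) (i : N ⟶ F), Mono i →
          IsDGFlat F → IsDGFlat N] := by
  tfae_have 1 → 2 := fun hR =>
    ⟨hR.isLeftCoherent, fun M N hM hN h => hR.mem_subprojectivityDomain hM hN h⟩
  tfae_have 2 → 3 := fun ⟨hcoh, h⟩ => ⟨hcoh, fun M N _ hN n hn =>
    h _ N (isFinitelyPresentedComplex_shiftedSphere M n) hN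
      (mem_subprojectivityDomain_shiftedSphere_X hn)⟩
  -- Coherence makes `I` an admissible test module, and a projective `N_0` lies in every
  -- subprojectivity domain, since epimorphisms onto it split.
  tfae_have 3 → 1 := fun ⟨hcoh, h⟩ I hI =>
    I.projective_of_mem_subprojectivityDomain fun N hN _ =>
      h (ModuleCat.of R I) N (hcoh I hI) hN 0 fun B g _ f =>
        ⟨f ≫ Projective.factorThru (𝟙 _) g, by simp⟩
  tfae_have 1 → 4 := fun hR => ⟨hR.isLeftCoherent, fun F N i _ hF =>
    hR.isDGFlat_of_flat fun n => hR.isFlatLeftModule_of_injective (i.f n).hom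
      ((ModuleCat.mono_iff_injective (i.f n)).1 inferInstance) (hF.1 n)⟩
  tfae_have 4 → 1 := fun ⟨hcoh, h⟩ I hI => by
    -- Zero differentials make DG-flatness of the ambient complex follow from flatness of `R` alone.
    let i : zeroDiffComplex (fun _ => ModuleCat.of R I) ⟶
        zeroDiffComplex (fun _ => ModuleCat.of R R) :=
      { f := fun _ => ModuleCat.ofHom (Submodule.subtype I)
        comm' := fun _ _ _ => by simp [zeroDiffComplex] }
    have hi : Mono i := HomologicalComplex.mono_of_mono_f _ fun _ =>
      (ModuleCat.mono_iff_injective _).2 I.subtype_injective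
    have hflat : IsFlatLeftModule R I :=
      (h _ _ i hi (zeroDiffComplex_isDGFlat _ fun _ => isFlatLeftModule_self)).1 0
    have := hcoh I hI
    exact hflat.projective
  tfae_finish
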